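/- Let $D$ be the open unit disc in $\mathbb C$ and let $\varphi$ be an analytic function on $D$ having exactly $n \ge 0$ zeros in $D$, counted with multiplicity. Let $f$ be an analytic function on $D$ such that $|f|\le|\varphi|$ on $\partial D$ in the sense that, for every $\zeta\in\partial D$, $\limsup_{D\ni z\to\zeta}|f(z)/\varphi(z)|\le 1$. Suppose there are distinct points $\tau_1,\dots,\tau_k$ on $\partial D$ and positive integers $m_1,\dots,m_k$ with $\sum_{j=1}^k m_j=n+1$ such that, for each $j$, $|\varphi|$ is bounded below by a positive constant on $D\cap U_j$ for some neighbourhood $U_j$ of $\tau_j$, and $$f(z)=\varphi(z)+o\left(|z-\tau_j|^{2m_j-1}\right)\quad\text{as } D\ni z\to\tau_j .$$ Then $f\equiv\varphi$ on $D$. -/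

import Mathlib

open Filter Topology Asymptotics

/-- `φ` has exactly `n` zeros in the open unit disc, counted with multiplicity: the zero set in
the disc is finite and the orders of vanishing add up to `n`. -/
def HasExactlyZerosInDisc (φ : ℂ → ℂ) (n : ℕ) : Prop :=
  {z ∈ Metric.ball (0 : ℂ) 1 | φ z = 0}.Finite ∧
    ∑ᶠ z ∈ {z ∈ Metric.ball (0 : ℂ) 1 | φ z = 0}, analyticOrderAt φ z = (n : ℕ∞)

/-- `|f| ≤ |φ|` on the unit circle, for functions given only on the open unit disc:
`limsup |f(z)/φ(z)| ≤ 1` as `z` tends to `ζ` from inside the disc, for every `ζ` on the circle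
(written without the division). -/
def BoundaryNormLE (f φ : ℂ → ℂ) : Prop :=
  ∀ ζ ∈ Metric.sphere (0 : ℂ) 1, ∀ ε : ℝ, 0 < ε →
    ∀ᶠ z in 𝓝[Metric.ball (0 : ℂ) 1] ζ, ‖f z‖ ≤ (1 + ε) * ‖φ z‖

/-- `φ` is bounded away from zero on the part of the open unit disc near `τ`. -/
def AwayFromZeroNear (φ : ℂ → ℂ) (τ : ℂ) : Prop :=
  ∃ c : ℝ, 0 < c ∧ ∀ᶠ z in 𝓝[Metric.ball (0 : ℂ) 1] τ, c ≤ ‖φ z‖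

/-!
Let `a` run through the zeros of `φ` in the disc, with multiplicities `N a` adding up to `n`, and
write `φ = ∏ (z - a) ^ N a * ψ` with `ψ` zero-free. Consider

`K z = z * ∏ ((z - a) * (1 - conj a * z)) ^ N a / ∏ j, (-(z - τ j) ^ 2 * conj (τ j)) ^ m j`

and `W = (φ - f) / φ * K`.

* On the unit circle `(z - a) * (1 - conj a * z) = z * |z - a| ^ 2` and
  `-(z - τ) ^ 2 * conj τ = z * |z - τ| ^ 2`. Since `∑ m j = n + 1`, the powers of `z` cancel and `K`
  is nonnegative there (`exists_contactKernel_eq_ofReal`). As `Re (1 - f / φ) ≥ 0` at the circle,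
  `Re W` has nonnegative lower limits at the points of the circle other than the `τ j`.
* The zeros of `K` cancel the poles of `1 - f / φ`, so `W` is analytic in the disc, and `W 0 = 0`
  because of the factor `z`.
* At `τ j` the contact condition gives `W = o(1 / |z - τ j|)` (`isLittleO_mul_contactKernel`). By a
  Phragmén–Lindelöf argument such singularities do no harm: `Re W ≥ 0` in the whole disc
  (`re_nonneg_of_boundary`).

An analytic function with nonnegative real part that vanishes at the centre of the disc vanishes
identically (open mapping theorem), so `W = 0` and hence `f = φ`.

In the Phragmén–Lindelöf step, `s j z = τ j / (τ j - z)` has positive real part in the disc and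
modulus `1 / |z - τ j|`, so `W = o(s j)` at `τ j`. Adding `δ * ∑ j, s j` to `W` makes the real part
nonnegative near `τ j` wherever `Re (s j)` is comparable to `|s j|`. In the remaining part, where
`2 * Re (s j) < |Im (s j)|`, the real part of `-(s j) ^ 2` is positive and of order `|s j| ^ 2`, so a
small multiple of it dominates `W`, and the maximum principle applies.
-/

open scoped ComplexConjugate

/-! ### Maximum principles on bounded open sets -/

/-- The maximum modulus principle for functions that are only bounded in the limit at each
frontier point. Connectedness of `Ω` is not needed. -/
theorem norm_le_of_forall_mem_frontier_eventually_lt {Ω : Set ℂ} (hΩ : IsOpen Ω)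
    (hbdd : Bornology.IsBounded Ω) {G : ℂ → ℂ} (hG : DifferentiableOn ℂ G Ω) {M : ℝ}
    (hfr : ∀ p ∈ frontier Ω, ∀ M' > M, ∀ᶠ z in 𝓝[Ω] p, ‖G z‖ < M') :
    ∀ z ∈ Ω, ‖G z‖ ≤ M := by
  intro z₀ hz₀
  by_contra! hlt
  have hcl : ∀ C, ‖G z₀‖ ≤ C → IsClosed {z ∈ Ω | C ≤ ‖G z‖} := by
    intro C hC
    refine isClosed_of_closure_subset fun p hp => ?_
    have hpΩ : p ∈ Ω := by
      by_contra hn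
      have hpf : p ∈ frontier Ω := by
        rw [hΩ.frontier_eq]
        exact ⟨closure_mono (fun z hz => hz.1) hp, hn⟩
      have h1 := eventually_nhdsWithin_iff.1 (hfr p hpf C (hlt.trans_le hC))
      obtain ⟨z, hz1, hz2⟩ := ((mem_closure_iff_frequently.1 hp).and_eventually h1).exists
      exact absurd (hz2 hz1.1) (not_lt.2 hz1.2)
    refine ⟨hpΩ, ?_⟩
    by_contra! hn
    have h1 := ((hG.differentiableAt (hΩ.mem_nhds hpΩ)).continuousAt.norm).eventually_lt_const hn
    obtain ⟨z, hz1, hz2⟩ := ((mem_closure_iff_frequently.1 hp).and_eventually h1).exists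
    exact absurd hz2 (not_lt.2 hz1.2)
  have hcpt : ∀ C, ‖G z₀‖ ≤ C → IsCompact {z ∈ Ω | C ≤ ‖G z‖} := fun C hC =>
    Metric.isCompact_of_isClosed_isBounded (hcl C hC) (hbdd.subset fun z hz => hz.1)
  obtain ⟨z₁, ⟨hz₁, hz₁'⟩, hmax⟩ := (hcpt _ le_rfl).exists_isMaxOn ⟨z₀, hz₀, le_rfl⟩
    (hG.continuousOn.norm.mono fun z hz => hz.1)
  have hmax' : ∀ z ∈ Ω, ‖G z‖ ≤ ‖G z₁‖ := by
    intro z hz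
    by_cases h : ‖G z₀‖ ≤ ‖G z‖
    · exact hmax ⟨hz, h⟩
    · exact (not_le.1 h).le.trans hz₁'
  -- The set where the maximum is attained is compact, open and nonempty in `ℂ`.
  have hopen : IsOpen {z ∈ Ω | ‖G z₁‖ ≤ ‖G z‖} := by
    rw [isOpen_iff_mem_nhds]
    rintro p ⟨hp, hpm⟩
    have hloc : IsLocalMax (norm ∘ G) p := by
      filter_upwards [hΩ.mem_nhds hp] with z hz using (hmax' z hz).trans hpm
    have hd : ∀ᶠ z in 𝓝 p, DifferentiableAt ℂ G z := by
      filter_upwards [hΩ.mem_nhds hp] with z hz using hG.differentiableAt (hΩ.mem_nhds hz)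
    filter_upwards [Complex.eventually_eq_of_isLocalMax_norm hd hloc, hΩ.mem_nhds hp] with z hz hzΩ
    exact ⟨hzΩ, by rw [hz]; exact hpm⟩
  have huniv := IsClopen.eq_univ ⟨hcl _ hz₁', hopen⟩ ⟨z₁, hz₁, le_rfl⟩
  exact noncompact_univ ℂ (huniv ▸ hcpt _ hz₁')

theorem re_nonneg_of_forall_mem_frontier {Ω : Set ℂ} (hΩ : IsOpen Ω)
    (hbdd : Bornology.IsBounded Ω) {A : ℂ → ℂ} (hA : DifferentiableOn ℂ A Ω)
    (hfr : ∀ p ∈ frontier Ω, ∀ ε > 0, ∀ᶠ z in 𝓝[Ω] p, -ε < (A z).re) :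
    ∀ z ∈ Ω, 0 ≤ (A z).re := by
  have key := norm_le_of_forall_mem_frontier_eventually_lt (G := fun z => Complex.exp (-A z))
    (M := 1) hΩ hbdd hA.neg.cexp fun p hp M' hM' => by
      filter_upwards [hfr p hp (Real.log M') (Real.log_pos hM')] with z hz
      rw [Complex.norm_exp, Complex.neg_re, ← Real.lt_log_iff_exp_lt (by linarith)]
      linarith
  intro z hz
  have := key z hz
  simp only [Complex.norm_exp, Complex.neg_re, Real.exp_le_one_iff] at this
  linarith

/-! ### A Phragmén–Lindelöf principle in the disc -/

theorem re_div_sub_pos {z τ : ℂ} (hz : ‖z‖ < 1) (hτ : ‖τ‖ = 1) : 0 < (τ / (τ - z)).re := by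
  have hne : τ - z ≠ 0 := by
    rw [sub_ne_zero]; rintro rfl; linarith
  have hsq : (τ.re * τ.re + τ.im * τ.im) = 1 := by
    have := Complex.normSq_eq_norm_sq τ
    rw [hτ, Complex.normSq_apply] at this; linarith
  have hzq : (z.re * z.re + z.im * z.im) < 1 := by
    have := Complex.normSq_eq_norm_sq z
    rw [Complex.normSq_apply] at this; nlinarith [norm_nonneg z]
  rw [Complex.div_re, ← add_div]
  refine div_pos ?_ (Complex.normSq_pos.2 hne)
  simp only [Complex.sub_re, Complex.sub_im]
  nlinarith [sq_nonneg (τ.re - z.re), sq_nonneg (τ.im - z.im)]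

/-- If the real part of `W` has nonnegative lower limits at the circle outside finitely many points,
and `W = o(1 / |z - τ j|)` at each exceptional point `τ j`, then the real part is nonnegative. The
growth condition is sharp: minus the Poisson kernel at `τ j` is the real part of a function which
is `O(1 / |z - τ j|)`. -/
theorem re_nonneg_of_boundary {ι : Type*} [Fintype ι] {W : ℂ → ℂ} {τ : ι → ℂ}
    (hW : DifferentiableOn ℂ W (Metric.ball 0 1)) (hτ : ∀ j, ‖τ j‖ = 1)
    (hb : ∀ ζ : ℂ, ‖ζ‖ = 1 → (∀ j, ζ ≠ τ j) →
      ∀ ε > 0, ∀ᶠ z in 𝓝[Metric.ball 0 1] ζ, -ε < (W z).re)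
    (ho : ∀ j, W =o[𝓝[Metric.ball 0 1] (τ j)] fun z => (z - τ j)⁻¹) :
    ∀ z ∈ Metric.ball (0 : ℂ) 1, 0 ≤ (W z).re := by
  set D := Metric.ball (0 : ℂ) 1
  let s : ι → ℂ → ℂ := fun j z => τ j / (τ j - z)
  have hne : ∀ j, ∀ z ∈ D, τ j - z ≠ 0 := by
    intro j z hz h
    have h1 : ‖z‖ < 1 := mem_ball_zero_iff.1 hz
    rw [← sub_eq_zero.1 h, hτ j] at h1
    exact lt_irrefl _ h1
  have hspos : ∀ j, ∀ z ∈ D, 0 < (s j z).re := fun j z hz =>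
    re_div_sub_pos (mem_ball_zero_iff.1 hz) (hτ j)
  have hsd : ∀ j, DifferentiableOn ℂ (s j) D := fun j =>
    (differentiableOn_const _).div ((differentiableOn_const _).sub differentiableOn_id) (hne j)
  have hsn : ∀ j z, ‖s j z‖ = ‖z - τ j‖⁻¹ := by
    intro j z
    simp only [s, norm_div, hτ j, norm_sub_rev (τ j), one_div]
  have hat : ∀ {h : ℂ → ℂ}, DifferentiableOn ℂ h D → ∀ z ∈ D, ContinuousAt h z := fun hh z hz =>
    (hh.differentiableAt (Metric.isOpen_ball.mem_nhds hz)).continuousAt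
  -- It is enough to allow a small multiple of the positive functions `Re (s j)`.
  suffices H : ∀ z ∈ D, ∀ δ > 0, 0 ≤ (W z).re + δ * ∑ j, (s j z).re by
    intro z hz
    have h1 : Tendsto (fun δ : ℝ => (W z).re + δ * ∑ j, (s j z).re) (𝓝[>] 0)
        (𝓝 ((W z).re + 0 * ∑ j, (s j z).re)) := by
      refine Tendsto.mono_left ?_ nhdsWithin_le_nhds
      exact Continuous.tendsto (by fun_prop) _
    rw [zero_mul, add_zero] at h1
    exact ge_of_tendsto h1 (eventually_nhdsWithin_of_forall fun δ hδ => H z hz δ hδ)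
  intro z₀ hz₀ δ hδ
  have hr : ∀ j, ∃ r > 0, ∀ z ∈ D, ‖z - τ j‖ ≤ r → ‖W z‖ ≤ δ / 3 * ‖s j z‖ := by
    intro j
    have h1 := (ho j).def (c := δ / 3) (by positivity)
    rw [eventually_nhdsWithin_iff, Metric.eventually_nhds_iff] at h1
    obtain ⟨r, hr, h⟩ := h1
    refine ⟨r / 2, by positivity, fun z hz hzr => ?_⟩
    have := h (y := z) (by rw [dist_eq_norm]; linarith) hz
    rwa [norm_inv, ← hsn] at this
  choose r hr hWr using hr
  -- Where `Re (s j)` is comparable to `‖s j‖`, the term `δ * Re (s j)` absorbs `W`.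
  have hB : ∀ z ∈ D, ∀ j, ‖z - τ j‖ ≤ r j → |(s j z).im| ≤ 2 * (s j z).re →
      0 ≤ (W z).re + δ * ∑ j, (s j z).re := by
    intro z hz j h1 h2
    have h3 : (s j z).re ≤ ∑ j, (s j z).re :=
      Finset.single_le_sum (f := fun j => (s j z).re) (fun i _ => (hspos i z hz).le)
        (Finset.mem_univ j)
    have h4 := hWr j z hz h1
    have h5 := neg_le_of_abs_le (Complex.abs_re_le_norm (W z))
    have h6 := Complex.norm_le_abs_re_add_abs_im (s j z)
    rw [abs_of_pos (hspos j z hz)] at h6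
    have h7 := mul_le_mul_of_nonneg_left h3 hδ.le
    have h8 : δ / 3 * ‖s j z‖ ≤ δ / 3 * (3 * (s j z).re) := by gcongr; linarith
    linarith
  -- What is left: points which, for every `j`, are at distance more than `r j` from `τ j` or lie in
  -- the directions where `Re (s j)` is small compared with `|Im (s j)|`.
  let Ω : Set ℂ := {z ∈ D | ∀ j, r j < ‖z - τ j‖ ∨ 2 * (s j z).re < |(s j z).im|}
  by_cases hzΩ : z₀ ∈ Ω
  swap
  · have : ∃ j, ‖z₀ - τ j‖ ≤ r j ∧ |(s j z₀).im| ≤ 2 * (s j z₀).re := by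
      by_contra! hcon
      exact hzΩ ⟨hz₀, fun j => or_iff_not_imp_left.2 fun h => hcon j (not_lt.1 h)⟩
    obtain ⟨j, h1, h2⟩ := this
    exact hB z₀ hz₀ j h1 h2
  have hΩo : IsOpen Ω := by
    rw [isOpen_iff_mem_nhds]
    rintro z ⟨hz, hzj⟩
    have h1 : ∀ᶠ w in 𝓝 z, ∀ j, r j < ‖w - τ j‖ ∨ 2 * (s j w).re < |(s j w).im| := by
      rw [eventually_all]
      intro j
      have hc := hat (hsd j) z hz
      rcases hzj j with h | h
      · have : ContinuousAt (fun w => ‖w - τ j‖) z := by fun_prop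
        filter_upwards [this.eventually_const_lt h] with w hw using Or.inl hw
      · have h2 : ContinuousAt (fun w => 2 * (s j w).re) z :=
          continuousAt_const.mul (Complex.continuous_re.continuousAt.comp hc)
        have h3 : ContinuousAt (fun w => |(s j w).im|) z :=
          (Complex.continuous_im.continuousAt.comp hc).abs
        filter_upwards [h2.eventually_lt h3 h] with w hw using Or.inr hw
    filter_upwards [h1, Metric.isOpen_ball.mem_nhds hz] with w hw hw' using ⟨hw', hw⟩
  have hΩD : Ω ⊆ D := fun z hz => hz.1
  have hre_sq : ∀ w : ℂ, (w ^ 2).re = w.re ^ 2 - w.im ^ 2 := by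
    intro w; simp [sq]
  have hsq : ∀ z ∈ Ω, ∀ j, (s j z ^ 2).re ≤ (r j)⁻¹ ^ 2 := by
    rintro z ⟨hz, hzj⟩ j
    rcases hzj j with h | h
    · refine (Complex.re_le_norm _).trans ?_
      rw [norm_pow, hsn]
      have := hr j
      gcongr
    · rw [hre_sq]
      have h1 := hspos j z hz
      have h2 : (s j z).re ^ 2 ≤ (s j z).im ^ 2 := by
        rw [sq_le_sq, abs_of_pos h1]; linarith
      have := sq_nonneg (r j)⁻¹
      linarith
  -- The barrier `-s j ^ 2` beats the growth of `W` at `τ j` inside the region.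
  -- The constants `(r j)⁻¹ ^ 2` keep its contribution nonnegative throughout the region.
  have key : ∀ η > 0, 0 ≤ (W z₀).re + δ * ∑ j, (s j z₀).re
      + η * ∑ j, ((r j)⁻¹ ^ 2 - (s j z₀ ^ 2).re) := by
    intro η hη
    let A : ℂ → ℂ := fun z => W z + δ * ∑ j, s j z
      + η * ∑ j, ((((r j)⁻¹ ^ 2 : ℝ) : ℂ) - s j z ^ 2)
    have hAre : ∀ z, (A z).re = (W z).re + δ * ∑ j, (s j z).re
        + η * ∑ j, ((r j)⁻¹ ^ 2 - (s j z ^ 2).re) := by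
      intro z
      simp only [A, Complex.add_re, Complex.re_ofReal_mul, Complex.re_sum, Complex.sub_re,
        Complex.ofReal_re]
    have hlow : ∀ z ∈ Ω, (W z).re + δ * ∑ j, (s j z).re ≤ (A z).re := by
      intro z hz
      rw [hAre]
      have : 0 ≤ ∑ j, ((r j)⁻¹ ^ 2 - (s j z ^ 2).re) :=
        Finset.sum_nonneg fun j _ => sub_nonneg.2 (hsq z hz j)
      nlinarith
    have hsum : ∀ z ∈ D, 0 ≤ δ * ∑ j, (s j z).re := fun z hz =>
      mul_nonneg hδ.le (Finset.sum_nonneg fun j _ => (hspos j z hz).le)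
    have hAd : DifferentiableOn ℂ A Ω := by
      have hs' : ∀ j, DifferentiableOn ℂ (s j) Ω := fun j => (hsd j).mono hΩD
      refine ((hW.mono hΩD).add ?_).add ?_
      · exact (DifferentiableOn.fun_sum fun j _ => hs' j).const_mul _
      · exact (DifferentiableOn.fun_sum fun j _ => ((hs' j).pow 2).const_sub _).const_mul _
    rw [← hAre]
    refine re_nonneg_of_forall_mem_frontier hΩo (Metric.isBounded_ball.subset hΩD) hAd ?_ z₀ hzΩ
    intro p hp ε hε
    rw [hΩo.frontier_eq] at hp
    have hp1 : ‖p‖ ≤ 1 := by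
      have := closure_mono hΩD hp.1
      exact mem_closedBall_zero_iff.1 (Metric.closure_ball_subset_closedBall this)
    rcases hp1.lt_or_eq with hlt | heq
    · have hpD : p ∈ D := mem_ball_zero_iff.2 hlt
      have : ∃ j, ‖p - τ j‖ ≤ r j ∧ |(s j p).im| ≤ 2 * (s j p).re := by
        by_contra! hcon
        exact hp.2 ⟨hpD, fun j => or_iff_not_imp_left.2 fun h => hcon j (not_lt.1 h)⟩
      obtain ⟨j, h1, h2⟩ := this
      have h3 := hB p hpD j h1 h2
      have hc : ContinuousAt (fun z => (W z).re + δ * ∑ j, (s j z).re) p := by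
        refine (Complex.continuous_re.continuousAt.comp (hat hW p hpD)).add ?_
        refine continuousAt_const.mul (tendsto_finsetSum _ fun j _ => ?_)
        exact Complex.continuous_re.continuousAt.comp (hat (hsd j) p hpD)
      have h4 := hc.eventually_const_lt (show -ε < _ by linarith)
      filter_upwards [nhdsWithin_le_nhds h4, self_mem_nhdsWithin] with z hz hzΩ
      exact hz.trans_le (hlow z hzΩ)
    by_cases hpτ : ∀ j, p ≠ τ j
    · filter_upwards [nhdsWithin_mono p hΩD (hb p heq hpτ ε hε), self_mem_nhdsWithin] with z hz hzΩ
      have := hlow z hzΩ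
      have := hsum z hzΩ.1
      linarith
    · push Not at hpτ
      obtain ⟨j, rfl⟩ := hpτ
      let ρ := min (r j) (η * (3 / 5) / (δ / 3))
      have hρ : 0 < ρ := lt_min (hr j) (by positivity)
      filter_upwards [nhdsWithin_le_nhds (Metric.ball_mem_nhds (τ j) hρ), self_mem_nhdsWithin]
        with z hz hzΩ
      rw [Metric.mem_ball, dist_eq_norm] at hz
      have hzr : ‖z - τ j‖ ≤ r j := (hz.trans_le (min_le_left _ _)).le
      have hzη : ‖z - τ j‖ ≤ η * (3 / 5) / (δ / 3) := (hz.trans_le (min_le_right _ _)).le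
      have hsec := (hzΩ.2 j).resolve_left (not_lt.2 hzr)
      have h1 := hWr j z hzΩ.1 hzr
      have h2 := neg_le_of_abs_le (Complex.abs_re_le_norm (W z))
      have h3 : (r j)⁻¹ ^ 2 - (s j z ^ 2).re ≤ ∑ j, ((r j)⁻¹ ^ 2 - (s j z ^ 2).re) :=
        Finset.single_le_sum (f := fun j => (r j)⁻¹ ^ 2 - (s j z ^ 2).re)
          (fun i _ => sub_nonneg.2 (hsq z hzΩ i)) (Finset.mem_univ j)
      have h4 : 3 / 5 * ‖s j z‖ ^ 2 ≤ -(s j z ^ 2).re := by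
        have h5 : (2 * (s j z).re) ^ 2 ≤ (s j z).im ^ 2 := by
          rw [sq_le_sq, abs_of_pos (by linarith [hspos j z hzΩ.1])]; exact hsec.le
        rw [hre_sq, ← Complex.normSq_eq_norm_sq, Complex.normSq_apply]
        nlinarith
      have h6 : δ / 3 * ‖s j z‖ ≤ η * (3 / 5 * ‖s j z‖ ^ 2) := by
        have hpos : 0 < ‖z - τ j‖ := by
          rw [norm_sub_rev]; exact norm_pos_iff.2 (hne j z hzΩ.1)
        rw [le_div_iff₀ (by positivity)] at hzη
        have h7 : ‖s j z‖ * ‖z - τ j‖ = 1 := by rw [hsn]; exact inv_mul_cancel₀ hpos.ne'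
        calc δ / 3 * ‖s j z‖ = (‖z - τ j‖ * (δ / 3)) * ‖s j z‖ ^ 2 := by
              linear_combination (-(δ / 3) * ‖s j z‖) * h7
          _ ≤ (η * (3 / 5)) * ‖s j z‖ ^ 2 := by gcongr
          _ = _ := by ring
      have h8 := hsum z hzΩ.1
      have h9 := sq_nonneg (r j)⁻¹
      have h10 : η * (3 / 5 * ‖s j z‖ ^ 2) ≤ η * ∑ j, ((r j)⁻¹ ^ 2 - (s j z ^ 2).re) := by
        gcongr; linarith
      rw [hAre]
      linarith
  have h1 : Tendsto (fun η : ℝ => (W z₀).re + δ * ∑ j, (s j z₀).re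
      + η * ∑ j, ((r j)⁻¹ ^ 2 - (s j z₀ ^ 2).re)) (𝓝[>] 0)
      (𝓝 ((W z₀).re + δ * ∑ j, (s j z₀).re
        + 0 * ∑ j, ((r j)⁻¹ ^ 2 - (s j z₀ ^ 2).re))) := by
    refine Tendsto.mono_left ?_ nhdsWithin_le_nhds
    exact Continuous.tendsto (by fun_prop) _
  rw [zero_mul, add_zero] at h1
  exact ge_of_tendsto h1 (eventually_nhdsWithin_of_forall key)

theorem eq_zero_of_re_nonneg {W : ℂ → ℂ} (hW : AnalyticOnNhd ℂ W (Metric.ball 0 1))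
    (hre : ∀ z ∈ Metric.ball (0 : ℂ) 1, 0 ≤ (W z).re) (h0 : W 0 = 0) :
    ∀ z ∈ Metric.ball (0 : ℂ) 1, W z = 0 := by
  have h0D : (0 : ℂ) ∈ Metric.ball (0 : ℂ) 1 := Metric.mem_ball_self one_pos
  rcases hW.is_constant_or_isOpen (convex_ball (0 : ℂ) 1).isPreconnected with ⟨w, hw⟩ | hop
  · intro z hz
    rw [hw z hz, ← hw 0 h0D, h0]
  · have h1 := (hop _ subset_rfl Metric.isOpen_ball).mem_nhds ⟨0, h0D, h0⟩
    obtain ⟨ε, hε, hsub⟩ := Metric.mem_nhds_iff.1 h1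
    obtain ⟨z, hz, hzW⟩ := hsub (show (-(ε / 2 : ℝ) : ℂ) ∈ Metric.ball 0 ε by
      rw [mem_ball_zero_iff, norm_neg, Complex.norm_real, Real.norm_of_nonneg (by positivity)]
      linarith)
    have := hre z hz
    rw [hzW, Complex.neg_re, Complex.ofReal_re] at this
    linarith

/-! ### Factoring out zeros -/

theorem exists_eq_pow_mul_of_analyticOrderAt {h : ℂ → ℂ} {U : Set ℂ}
    (hh : AnalyticOnNhd ℂ h U) {a : ℂ} (ha : a ∈ U) {N : ℕ} (hN : analyticOrderAt h a = N) :
    ∃ g : ℂ → ℂ, AnalyticOnNhd ℂ g U ∧ g a ≠ 0 ∧ ∀ z ∈ U, h z = (z - a) ^ N * g z := by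
  obtain ⟨g₀, hg₀, hne, heq⟩ := (hh a ha).analyticOrderAt_eq_natCast.1 hN
  let g := Function.update (fun z => h z / (z - a) ^ N) a (g₀ a)
  have hga : g =ᶠ[𝓝 a] g₀ := by
    filter_upwards [heq] with z hz
    rcases eq_or_ne z a with rfl | hza
    · simp [g]
    · simp only [g, Function.update_of_ne hza, hz, smul_eq_mul]
      exact mul_div_cancel_left₀ _ (pow_ne_zero _ (sub_ne_zero.2 hza))
  refine ⟨g, fun z hz => ?_, by simpa [g] using hne, fun z hz => ?_⟩
  · rcases eq_or_ne z a with rfl | hza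
    · exact hg₀.congr hga.symm
    · have : AnalyticAt ℂ (fun z => h z / (z - a) ^ N) z :=
        (hh z hz).div (by fun_prop) (pow_ne_zero _ (sub_ne_zero.2 hza))
      refine this.congr ?_
      filter_upwards [isOpen_ne.mem_nhds hza] with w hw
      simp only [g, Function.update_of_ne hw]
  · rcases eq_or_ne z a with rfl | hza
    · rw [hga.self_of_nhds, heq.self_of_nhds, smul_eq_mul]
    · simp only [g, Function.update_of_ne hza]
      rw [mul_div_cancel₀ _ (pow_ne_zero _ (sub_ne_zero.2 hza))]

theorem exists_eq_prod_pow_mul {h : ℂ → ℂ} {U : Set ℂ} (hU : IsOpen U)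
    (hh : AnalyticOnNhd ℂ h U) (N : ℂ → ℕ) (S : Finset ℂ) (hS : ∀ a ∈ S, a ∈ U)
    (hN : ∀ a ∈ S, analyticOrderAt h a = N a) :
    ∃ g : ℂ → ℂ, AnalyticOnNhd ℂ g U ∧ (∀ a ∈ S, g a ≠ 0) ∧
      ∀ z ∈ U, h z = (∏ a ∈ S, (z - a) ^ N a) * g z := by
  induction S using Finset.induction_on with
  | empty => exact ⟨h, hh, by simp, by simp⟩
  | insert b S hb ih =>
    obtain ⟨g, hg, hgne, hgeq⟩ := ih (fun a ha => hS a (Finset.mem_insert_of_mem ha))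
      fun a ha => hN a (Finset.mem_insert_of_mem ha)
    have hbU := hS b (Finset.mem_insert_self b S)
    have hPa : AnalyticAt ℂ (fun z : ℂ => ∏ a ∈ S, (z - a) ^ N a) b := by fun_prop
    have hP0 : analyticOrderAt (fun z : ℂ => ∏ a ∈ S, (z - a) ^ N a) b = 0 := by
      rw [hPa.analyticOrderAt_eq_zero, Finset.prod_ne_zero_iff]
      intro a ha
      exact pow_ne_zero _ (sub_ne_zero.2 fun h => hb (h ▸ ha))
    have hgb : analyticOrderAt g b = N b := by
      rw [← hN b (Finset.mem_insert_self b S)]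
      have : h =ᶠ[𝓝 b] (fun z : ℂ => ∏ a ∈ S, (z - a) ^ N a) * g := by
        filter_upwards [hU.mem_nhds hbU] with z hz using hgeq z hz
      rw [analyticOrderAt_congr this, analyticOrderAt_mul hPa (hg b hbU), hP0, zero_add]
    obtain ⟨g', hg', hg'b, hg'eq⟩ := exists_eq_pow_mul_of_analyticOrderAt hg hbU hgb
    refine ⟨g', hg', fun a ha => ?_, fun z hz => ?_⟩
    · rcases Finset.mem_insert.1 ha with rfl | ha
      · exact hg'b
      · have := hgne a ha
        rw [hg'eq a (hS a (Finset.mem_insert_of_mem ha))] at this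
        exact right_ne_zero_of_mul this
    · rw [hgeq z hz, hg'eq z hz, Finset.prod_insert hb]
      ring

theorem HasExactlyZerosInDisc.exists_finset {φ : ℂ → ℂ} {n : ℕ} (h : HasExactlyZerosInDisc φ n) :
    ∃ (S : Finset ℂ) (N : ℂ → ℕ), (∀ a, a ∈ S ↔ a ∈ Metric.ball (0 : ℂ) 1 ∧ φ a = 0) ∧
      (∀ a ∈ S, analyticOrderAt φ a = N a) ∧ ∑ a ∈ S, N a = n := by
  obtain ⟨hfin, hsum⟩ := h
  rw [finsum_mem_eq_finite_toFinset_sum _ hfin] at hsum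
  have hN : ∀ a ∈ hfin.toFinset, analyticOrderAt φ a = ((analyticOrderAt φ a).toNat : ℕ∞) := by
    intro a ha
    refine (ENat.natCast_toNat fun htop => ?_).symm
    have h1 := Finset.single_le_sum (f := fun a => analyticOrderAt φ a) (fun _ _ => zero_le) ha
    rw [hsum] at h1
    simp [htop] at h1
  refine ⟨hfin.toFinset, fun a => (analyticOrderAt φ a).toNat, fun a => by simp, hN, ?_⟩
  rw [Finset.sum_congr rfl hN] at hsum
  exact_mod_cast hsum

/-! ### A kernel that is nonnegative on the circle -/

theorem mul_one_sub_conj_mul_of_norm_eq_one {ζ : ℂ} (hζ : ‖ζ‖ = 1) (a : ℂ) :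
    (ζ - a) * (1 - conj a * ζ) = ζ * ((‖ζ - a‖ ^ 2 : ℝ) : ℂ) := by
  have h1 : ζ * conj ζ = 1 := by rw [Complex.mul_conj', hζ]; norm_num
  rw [Complex.ofReal_pow, ← Complex.mul_conj', map_sub]
  linear_combination -(ζ - a) * h1

theorem neg_sub_sq_mul_conj_of_norm_eq_one {ζ τ : ℂ} (hζ : ‖ζ‖ = 1) (hτ : ‖τ‖ = 1) :
    -(ζ - τ) ^ 2 * conj τ = ζ * ((‖ζ - τ‖ ^ 2 : ℝ) : ℂ) := by
  have h2 : τ * conj τ = 1 := by rw [Complex.mul_conj', hτ]; norm_num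
  rw [← mul_one_sub_conj_mul_of_norm_eq_one hζ]
  linear_combination (ζ - τ) * h2

/-- A rational function with zeros at the `a ∈ S` of order `N a`, poles at the `τ j` of order
`2 * m j`, and, besides the reflected zeros `1 / conj a`, a zero at the origin. If the `τ j` lie on
the unit circle and `∑ m j = ∑ N a + 1`, it is real and nonnegative on the circle. -/
noncomputable def contactKernel {ι : Type*} [Fintype ι] (S : Finset ℂ) (N : ℂ → ℕ) (τ : ι → ℂ)
    (m : ι → ℕ) (z : ℂ) : ℂ :=
  z * (∏ a ∈ S, ((z - a) * (1 - conj a * z)) ^ N a) / ∏ j, (-(z - τ j) ^ 2 * conj (τ j)) ^ m j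

theorem exists_contactKernel_eq_ofReal {ι : Type*} [Fintype ι] {S : Finset ℂ} {N : ℂ → ℕ}
    {τ : ι → ℂ} {m : ι → ℕ} (hτ : ∀ j, ‖τ j‖ = 1) (hsum : ∑ j, m j = ∑ a ∈ S, N a + 1)
    {ζ : ℂ} (hζ : ‖ζ‖ = 1) : ∃ r : ℝ, 0 ≤ r ∧ contactKernel S N τ m ζ = r := by
  -- If the denominator vanishes at `ζ`, both sides are zero by the convention for division by zero.
  refine ⟨(∏ a ∈ S, (‖ζ - a‖ ^ 2) ^ N a) / ∏ j, (‖ζ - τ j‖ ^ 2) ^ m j, by positivity, ?_⟩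
  have hζ0 : ζ ≠ 0 := by rintro rfl; simp at hζ
  simp only [contactKernel, mul_one_sub_conj_mul_of_norm_eq_one hζ,
    neg_sub_sq_mul_conj_of_norm_eq_one hζ (hτ _), mul_pow, Finset.prod_mul_distrib,
    Finset.prod_pow_eq_pow_sum, hsum]
  rw [← mul_assoc, ← pow_succ', mul_div_mul_left _ _ (pow_ne_zero _ hζ0)]
  push_cast
  rfl

/-- Since `Re (1 - f / φ)` has nonnegative lower limits at the circle and `1 - f / φ` is bounded
there, the sign survives multiplication by a function with a nonnegative boundary value. -/
theorem eventually_re_mul_gt_of_boundaryNormLE {f φ K : ℂ → ℂ} (h : BoundaryNormLE f φ) {ζ : ℂ}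
    (hζ : ‖ζ‖ = 1) (hφ : ∀ᶠ z in 𝓝[Metric.ball (0 : ℂ) 1] ζ, φ z ≠ 0) (hK : ContinuousAt K ζ)
    {r : ℝ} (hr : 0 ≤ r) (hKr : K ζ = r) {ε : ℝ} (hε : 0 < ε) :
    ∀ᶠ z in 𝓝[Metric.ball (0 : ℂ) 1] ζ, -ε < ((φ z - f z) / φ z * K z).re := by
  let δ := min 1 (ε / (2 * (r + 1)))
  have hδ : 0 < δ := lt_min one_pos (by positivity)
  have hK' : ∀ᶠ z in 𝓝[Metric.ball (0 : ℂ) 1] ζ, ‖K z - r‖ < ε / 6 := by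
    have : ContinuousAt (fun z => ‖K z - r‖) ζ := (hK.sub continuousAt_const).norm
    exact nhdsWithin_le_nhds (this.eventually_lt_const (by simpa [hKr] using by positivity))
  filter_upwards [h ζ (by simpa using hζ) δ hδ, hφ, hK'] with z h1 h2 h3
  have hq : ‖f z / φ z‖ ≤ 1 + δ := by
    rw [norm_div, div_le_iff₀ (norm_pos_iff.2 h2)]; exact h1
  have hu : (φ z - f z) / φ z = 1 - f z / φ z := by rw [sub_div, div_self h2]
  rw [hu]
  have h4 : -δ ≤ (1 - f z / φ z).re := by
    have := (Complex.re_le_norm _).trans hq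
    rw [Complex.sub_re, Complex.one_re]; linarith
  have h5 : ‖1 - f z / φ z‖ ≤ 3 := by
    have := norm_sub_le (1 : ℂ) (f z / φ z)
    have h7 : δ ≤ 1 := min_le_left _ _
    rw [norm_one] at this; linarith
  have h6 : ‖(1 - f z / φ z) * (K z - r)‖ ≤ 3 * (ε / 6) := by
    rw [norm_mul]; gcongr
  have h7 := neg_le_of_abs_le ((Complex.abs_re_le_norm _).trans h6)
  have h8 : δ * (r + 1) ≤ ε / 2 := by
    have : δ ≤ ε / (2 * (r + 1)) := min_le_right _ _
    rw [le_div_iff₀ (by positivity)] at this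
    linarith
  have h9 : ((1 - f z / φ z) * K z).re
      = r * (1 - f z / φ z).re + ((1 - f z / φ z) * (K z - r)).re := by
    rw [← Complex.re_ofReal_mul, ← Complex.add_re]; ring_nf
  rw [h9]
  have h10 : r * -δ ≤ r * (1 - f z / φ z).re := by gcongr
  nlinarith

/-- The pole of order `2 * m j` of the kernel at `τ j` against the contact of order `2 * m j - 1`. -/
theorem isLittleO_mul_contactKernel {ι : Type*} [Fintype ι] {S : Finset ℂ} {N : ℂ → ℕ}
    {τ : ι → ℂ} {m : ι → ℕ} (hτ : ∀ j, ‖τ j‖ = 1) (hτ_inj : Function.Injective τ)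
    {φ f : ℂ → ℂ} {j : ι} (hm : 0 < m j) (haway : AwayFromZeroNear φ (τ j))
    (hcontact : (fun z => f z - φ z) =o[𝓝[Metric.ball (0 : ℂ) 1] (τ j)]
      (fun z => ‖z - τ j‖ ^ (2 * m j - 1))) :
    (fun z => (φ z - f z) / φ z * contactKernel S N τ m z) =o[𝓝[Metric.ball (0 : ℂ) 1] (τ j)]
      (fun z => (z - τ j)⁻¹) := by
  classical
  let q : ι → ℂ → ℂ := fun i z => (-(z - τ i) ^ 2 * conj (τ i)) ^ m i
  -- The kernel without its pole at `τ j`.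
  let H : ℂ → ℂ := fun z =>
    z * (∏ a ∈ S, ((z - a) * (1 - conj a * z)) ^ N a) / ∏ i ∈ Finset.univ.erase j, q i z
  have hK : ∀ z, contactKernel S N τ m z = H z * (q j z)⁻¹ := by
    intro z
    simp only [contactKernel, H]
    rw [← Finset.mul_prod_erase Finset.univ (fun i => q i z) (Finset.mem_univ j), ← div_eq_mul_inv,
      div_div, mul_comm (q j z)]
  have hne : ∏ i ∈ Finset.univ.erase j, q i (τ j) ≠ 0 := by
    refine Finset.prod_ne_zero_iff.2 fun i hi => pow_ne_zero _ (mul_ne_zero ?_ ?_)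
    · refine neg_ne_zero.2 (pow_ne_zero _ (sub_ne_zero.2 fun h => ?_))
      exact Finset.ne_of_mem_erase hi (hτ_inj h).symm
    · rw [← norm_ne_zero_iff, RCLike.norm_conj, hτ]; exact one_ne_zero
  have hH : H =O[𝓝[Metric.ball (0 : ℂ) 1] (τ j)] (fun _ => (1 : ℂ)) := by
    have : ContinuousAt H (τ j) := by
      refine ContinuousAt.div (Continuous.continuousAt (by fun_prop)) ?_ hne
      exact Continuous.continuousAt (by fun_prop)
    exact (this.isBigO_one ℂ).mono nhdsWithin_le_nhds
  have hφ : (fun z => (φ z)⁻¹) =O[𝓝[Metric.ball (0 : ℂ) 1] (τ j)] (fun _ => (1 : ℂ)) := by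
    obtain ⟨c, hc, h⟩ := haway
    refine IsBigO.of_bound c⁻¹ ?_
    filter_upwards [h] with z hz
    rw [norm_inv, norm_one, mul_one]
    exact inv_anti₀ hc hz
  have hmain : (fun z => (f z - φ z) * (q j z)⁻¹) =o[𝓝[Metric.ball (0 : ℂ) 1] (τ j)]
      (fun z => (z - τ j)⁻¹) := by
    have h1 := hcontact.mul_isBigO
      (isBigO_refl (fun z => (q j z)⁻¹) (𝓝[Metric.ball (0 : ℂ) 1] (τ j))).norm_right
    refine h1.trans_isBigO (IsBigO.of_bound 1 ?_)
    filter_upwards [self_mem_nhdsWithin] with z hz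
    have hpos : 0 < ‖z - τ j‖ := by
      refine norm_pos_iff.2 (sub_ne_zero.2 fun h => ?_)
      rw [h, mem_ball_zero_iff, hτ] at hz
      exact lt_irrefl _ hz
    obtain ⟨d, hd⟩ : ∃ d, 2 * m j = d + 1 := ⟨2 * m j - 1, by omega⟩
    have hq : ‖q j z‖ = ‖z - τ j‖ ^ (d + 1) := by
      simp only [q, norm_pow, norm_mul, norm_neg, RCLike.norm_conj, hτ, mul_one]
      rw [← pow_mul, hd]
    rw [norm_mul, norm_norm, norm_inv, norm_inv, hq, hd, Nat.add_sub_cancel, norm_pow, norm_norm,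
      one_mul, pow_succ, mul_inv, mul_inv_cancel_left₀ (pow_ne_zero _ hpos.ne')]
  have h2 := hmain.neg_left.mul_isBigO (hφ.mul hH)
  refine h2.congr (fun z => ?_) fun z => by rw [mul_one, mul_one]
  rw [hK]
  ring

/-! ### Boundary uniqueness -/

theorem theorem1 (n : ℕ) (φ f : ℂ → ℂ)
    (hφ : AnalyticOnNhd ℂ φ (Metric.ball (0 : ℂ) 1))
    (hzeros : HasExactlyZerosInDisc φ n)
    (hf : AnalyticOnNhd ℂ f (Metric.ball (0 : ℂ) 1))
    (hbdry : BoundaryNormLE f φ)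
    (k : ℕ) (τ : Fin k → ℂ) (hτ : ∀ j, τ j ∈ Metric.sphere (0 : ℂ) 1)
    (hτ_inj : Function.Injective τ)
    (m : Fin k → ℕ) (hm : ∀ j, 0 < m j) (hsum : ∑ j, m j = n + 1)
    (haway : ∀ j, AwayFromZeroNear φ (τ j))
    (hcontact : ∀ j, (fun z => f z - φ z) =o[𝓝[Metric.ball (0 : ℂ) 1] (τ j)]
      (fun z => ‖z - τ j‖ ^ (2 * m j - 1))) :
    Set.EqOn f φ (Metric.ball (0 : ℂ) 1) := by
  obtain ⟨S, N, hS, hN, hNsum⟩ := hzeros.exists_finset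
  obtain ⟨ψ, hψ, hψS, hφψ⟩ :=
    exists_eq_prod_pow_mul Metric.isOpen_ball hφ N S (fun a ha => ((hS a).1 ha).1) hN
  have hτ1 : ∀ j, ‖τ j‖ = 1 := fun j => mem_sphere_zero_iff_norm.1 (hτ j)
  have hψ0 : ∀ z ∈ Metric.ball (0 : ℂ) 1, ψ z ≠ 0 := by
    intro z hz h
    by_cases hzS : z ∈ S
    · exact hψS z hzS h
    · exact hzS ((hS z).2 ⟨hz, by rw [hφψ z hz, h, mul_zero]⟩)
  have hden : ∀ z : ℂ, (∀ j, z ≠ τ j) → ∏ j, (-(z - τ j) ^ 2 * conj (τ j)) ^ m j ≠ 0 := by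
    intro z hz
    refine Finset.prod_ne_zero_iff.2 fun j _ => pow_ne_zero _ (mul_ne_zero ?_ ?_)
    · exact neg_ne_zero.2 (pow_ne_zero _ (sub_ne_zero.2 (hz j)))
    · rw [← norm_ne_zero_iff, RCLike.norm_conj, hτ1]; exact one_ne_zero
  have hDτ : ∀ z ∈ Metric.ball (0 : ℂ) 1, ∀ j, z ≠ τ j := by
    rintro z hz j rfl
    rw [mem_ball_zero_iff, hτ1] at hz
    exact lt_irrefl _ hz
  -- This is `(φ - f) / φ` times the kernel, with the factors `z - a` cancelled.
  let W : ℂ → ℂ := fun z => z * (φ z - f z) / ψ z * (∏ a ∈ S, (1 - conj a * z) ^ N a) /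
    ∏ j, (-(z - τ j) ^ 2 * conj (τ j)) ^ m j
  have hW : AnalyticOnNhd ℂ W (Metric.ball 0 1) := by
    intro z hz
    have h1 : AnalyticAt ℂ (fun z : ℂ => ∏ a ∈ S, (1 - conj a * z) ^ N a) z := by fun_prop
    have h2 : AnalyticAt ℂ (fun z : ℂ => ∏ j, (-(z - τ j) ^ 2 * conj (τ j)) ^ m j) z := by fun_prop
    exact (((analyticAt_id.mul ((hφ z hz).sub (hf z hz))).div (hψ z hz) (hψ0 z hz)).mul h1).div h2
      (hden z (hDτ z hz))
  have hWK : ∀ z ∈ Metric.ball (0 : ℂ) 1, φ z ≠ 0 →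
      W z = (φ z - f z) / φ z * contactKernel S N τ m z := by
    intro z hz hφz
    have h1 := hφψ z hz
    have hP : ∏ a ∈ S, (z - a) ^ N a ≠ 0 := left_ne_zero_of_mul (h1 ▸ hφz)
    have h2 := hψ0 z hz
    have h3 := hden z (hDτ z hz)
    simp only [W, contactKernel, mul_pow, Finset.prod_mul_distrib] at h3 ⊢
    generalize φ z - f z = u
    rw [h1]
    field_simp
  have hev : ∀ ζ : ℂ, ‖ζ‖ = 1 → ∀ᶠ z in 𝓝[Metric.ball (0 : ℂ) 1] ζ, φ z ≠ 0 := by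
    intro ζ hζ
    have h1 : (S : Set ℂ)ᶜ ∈ 𝓝 ζ := by
      refine S.finite_toSet.isClosed.isOpen_compl.mem_nhds fun h => ?_
      have := ((hS ζ).1 h).1
      rw [mem_ball_zero_iff, hζ] at this
      exact lt_irrefl _ this
    filter_upwards [nhdsWithin_le_nhds h1, self_mem_nhdsWithin] with z hz hzD h
    exact hz ((hS z).2 ⟨hzD, h⟩)
  have hWK' : ∀ ζ : ℂ, ‖ζ‖ = 1 → W =ᶠ[𝓝[Metric.ball (0 : ℂ) 1] ζ]
      fun z => (φ z - f z) / φ z * contactKernel S N τ m z := by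
    intro ζ hζ
    filter_upwards [hev ζ hζ, self_mem_nhdsWithin] with z hz hzD using hWK z hzD hz
  have hre : ∀ z ∈ Metric.ball (0 : ℂ) 1, 0 ≤ (W z).re := by
    refine re_nonneg_of_boundary hW.differentiableOn hτ1 (fun ζ hζ hζτ ε hε => ?_) fun j => ?_
    · obtain ⟨r, hr, hKr⟩ :=
        exists_contactKernel_eq_ofReal (S := S) (N := N) hτ1 (hsum.trans (by rw [hNsum])) hζ
      have hK : ContinuousAt (contactKernel S N τ m) ζ := by
        refine ContinuousAt.div (Continuous.continuousAt (by fun_prop)) ?_ (hden ζ hζτ)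
        exact Continuous.continuousAt (by fun_prop)
      filter_upwards [hWK' ζ hζ,
        eventually_re_mul_gt_of_boundaryNormLE hbdry hζ (hev ζ hζ) hK hr hKr hε] with z h1 h2
      rw [h1]; exact h2
    · exact (isLittleO_mul_contactKernel hτ1 hτ_inj (hm j) (haway j) (hcontact j)).congr'
        (hWK' (τ j) (hτ1 j)).symm EventuallyEq.rfl
  have hW0 := eq_zero_of_re_nonneg hW hre (by simp [W])
  -- Because of the factor `z` in `W`, equality is read off only away from the origin.
  have h0D : (0 : ℂ) ∈ Metric.ball (0 : ℂ) 1 := Metric.mem_ball_self one_pos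
  refine hf.eqOn_of_preconnected_of_frequently_eq hφ (convex_ball (0 : ℂ) 1).isPreconnected h0D ?_
  refine Eventually.frequently ?_
  filter_upwards [self_mem_nhdsWithin, nhdsWithin_le_nhds (Metric.isOpen_ball.mem_nhds h0D)]
    with z hz hzD
  have hE : ∏ a ∈ S, (1 - conj a * z) ^ N a ≠ 0 := by
    refine Finset.prod_ne_zero_iff.2 fun a ha => pow_ne_zero _ (sub_ne_zero.2 fun h => ?_)
    have h1 : ‖a‖ < 1 := mem_ball_zero_iff.1 ((hS a).1 ha).1
    have h2 : ‖z‖ < 1 := mem_ball_zero_iff.1 hzD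
    have h3 := congrArg norm h
    rw [norm_one, norm_mul, RCLike.norm_conj] at h3
    nlinarith [norm_nonneg a, norm_nonneg z]
  have h1 := hW0 z hzD
  simp only [W, div_eq_zero_iff, mul_eq_zero, hE, hden z (hDτ z hzD), hψ0 z hzD, or_false] at h1
  exact (sub_eq_zero.1 (h1.resolve_left hz)).symm
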